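/- Let $\Lambda,H\in\mathbf{M}_2(\mathbb{R})$ be symmetric, with $\Lambda$ positive definite and $H$ invertible, let $\theta\ge 0$, let $\Sigma\in C^0(\mathbb{R}^2;\mathbf{M}_2(\mathbb{R}))$, let $K_1,K_2,K_3\in C^0([0,1];\mathbf{M}_2(\mathbb{R}))$ with $K_1(\xi)$ symmetric and invertible, and let $K_4\in\mathbf{M}_2(\mathbb{R})$. Assume that $\mathscr{Q}(\xi)=K_1(\xi)H^{-1}$ is symmetric and positive definite for every $\xi\in[0,1]$. For $\mathbb{R}^2$-valued or $\mathbf{M}_2(\mathbb{R})$-valued functions $\zeta$ on $[0,1]$ put $$\mathscr{K}_1\zeta=\int_0^1K_1\zeta\,d\xi,\qquad \mathscr{K}_2\zeta=\int_0^1K_2\zeta\,d\xi,\qquad \mathscr{K}_3\zeta=\int_0^1K_3\zeta\,d\xi+K_4\zeta(1),$$ let $D=\{\zeta\in H^1((0,1);\mathbb{R}^2):\zeta(0)=0\}$, and for $\zeta\in D$, $y\in\mathbb{R}^2$ put $$\mathscr{A}\zeta=-\Lambda\zeta'+\mathscr{K}_3\zeta,\qquad \mathscr{A}_\Sigma(y)\zeta=\theta\Sigma(y)[\zeta+\mathscr{K}_2\zeta]+\mathscr{A}\zeta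 .$$ Assume: (i) there is $\omega>0$ with $\langle\mathscr{A}\zeta,\mathscr{Q}\zeta\rangle_{L^2((0,1);\mathbb{R}^2)}\le-\omega\|\zeta\|^2_{L^2((0,1);\mathbb{R}^2)}$ for all $\zeta\in D$; (ii) $\int_0^1\zeta^{\mathrm T}(\xi)\mathscr{Q}(\xi)\Sigma(y)[\zeta(\xi)+\mathscr{K}_2\zeta]\,d\xi\le0$ for all $y\in\mathbb{R}^2$, $\zeta\in L^2((0,1);\mathbb{R}^2)$, and $\Sigma$ is globally Lipschitz continuous. Then for every $y\in\mathbb{R}^2$ the operator $\mathscr{A}_\Sigma(y):D\to L^2((0,1);\mathbb{R}^2)$ is bijective, the matrix $\Psi(y)=-\mathscr{K}_1\mathscr{A}_\Sigma(y)^{-1}H$ (where $\mathscr{A}_\Sigma(y)^{-1}$ acts on the columns of $H$, seen as constant functions) is invertible, and the nonlocal matrix problem $$\Lambda\,\partial_\xi M(\xi,y)=\theta\Sigma(y)\bigl[M(\xi,y)+(\mathscr{K}_2M)(y)\bigr]+(\mathscr{K}_3M)(y)+H\Psi(y)^{-1},\quad \xi\in(0,1),\qquad M(0,y)=0,$$ has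 a unique solution $M(\cdot,y)\in C^1([0,1];\mathbf{M}_2(\mathbb{R}))$. This solution is $M(\xi,y)=-(\mathscr{A}_\Sigma(y)^{-1}H)(\xi)\,\Psi(y)^{-1}$ for $\xi\in[0,1]$, and it satisfies $(\mathscr{K}_1M)(y)=I_2$. -/

import Mathlib

open MeasureTheory Set
open scoped Matrix Matrix.Norms.L2Operator RealInnerProductSpace

noncomputable section

/-- The Euclidean plane. -/
abbrev R2 : Type := EuclideanSpace ℝ (Fin 2)

/-- Real `2 × 2` matrices, normed (where a norm is used) by the operator norm of the Euclidean
norm. -/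
abbrev Mat2 : Type := Matrix (Fin 2) (Fin 2) ℝ

/-- Matrix-vector product on the Euclidean plane. -/
abbrev Mat2.act (A : Mat2) (v : R2) : R2 := Matrix.toEuclideanCLM (𝕜 := ℝ) A v

/-- The `j`-th column of a matrix, as a vector of the Euclidean plane. -/
def Mat2.column (A : Mat2) (j : Fin 2) : R2 := WithLp.toLp 2 (fun i => A i j)

/-- Lebesgue measure on the interval `(0,1)`. -/
abbrev unitMeasure : Measure ℝ := volume.restrict (Ioo (0 : ℝ) 1)

/-- `L²((0,1); ℝ²)`, as a condition on functions. Equality in this space is equality almost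
everywhere with respect to `unitMeasure`. -/
def MemL2 (f : ℝ → R2) : Prop := MemLp f 2 unitMeasure

/-- `H¹((0,1); ℝ²)`: the absolutely continuous functions on `[0,1]` whose derivative, which exists
almost everywhere, is square integrable. Elements are thus given by their continuous representative,
so that the traces at `0` and at `1` are the values there; two functions are the same element
exactly when they agree on `[0,1]`. -/
def MemH1 (ζ : ℝ → R2) : Prop :=
  AbsolutelyContinuousOnInterval ζ 0 1 ∧ MemL2 (deriv ζ)

/-- The data of the distributed friction system: the transport matrix `Λ`, the source matrix
`Σ` (`source`) with the parameter `θ`, the input matrix `H`, and the kernels of the functionals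
`𝒦₁`, `𝒦₂`, `𝒦₃`. -/
structure FrictionSystem where
  Λ : Mat2
  H : Mat2
  θ : ℝ
  source : R2 → Mat2
  K₁ : ℝ → Mat2
  K₂ : ℝ → Mat2
  K₃ : ℝ → Mat2
  K₄ : Mat2
  Λ_posDef : Λ.PosDef
  H_isUnit : IsUnit H
  H_isSymm : H.IsSymm
  θ_nonneg : 0 ≤ θ
  source_continuous : Continuous source
  K₁_continuousOn : ContinuousOn K₁ (Icc 0 1)
  K₂_continuousOn : ContinuousOn K₂ (Icc 0 1)
  K₃_continuousOn : ContinuousOn K₃ (Icc 0 1)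
  K₁_isUnit : ∀ ξ ∈ Icc (0 : ℝ) 1, IsUnit (K₁ ξ)
  K₁_isSymm : ∀ ξ ∈ Icc (0 : ℝ) 1, (K₁ ξ).IsSymm
  /-- The weight `K₁(ξ) H⁻¹` is symmetric and positive definite. -/
  weight_posDef : ∀ ξ ∈ Icc (0 : ℝ) 1, (K₁ ξ * H⁻¹).PosDef

namespace FrictionSystem

variable (S : FrictionSystem)

/-- The weight `𝒬(ξ) = K₁(ξ) H⁻¹`. -/
def Q (ξ : ℝ) : Mat2 := S.K₁ ξ * S.H⁻¹

/-! The functionals on vector-valued functions. -/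

/-- `𝒦₁ζ = ∫₀¹ K₁ ζ`. -/
def opK₁ (ζ : ℝ → R2) : R2 := ∫ ξ in (0 : ℝ)..1, (S.K₁ ξ).act (ζ ξ)

/-- `𝒦₂ζ = ∫₀¹ K₂ ζ`. -/
def opK₂ (ζ : ℝ → R2) : R2 := ∫ ξ in (0 : ℝ)..1, (S.K₂ ξ).act (ζ ξ)

/-- `𝒦₃ζ = ∫₀¹ K₃ ζ + K₄ ζ(1)`. -/
def opK₃ (ζ : ℝ → R2) : R2 := (∫ ξ in (0 : ℝ)..1, (S.K₃ ξ).act (ζ ξ)) + S.K₄.act (ζ 1)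

/-! The same functionals on matrix-valued functions. -/

/-- `𝒦₁M = ∫₀¹ K₁ M`. -/
def matK₁ (M : ℝ → Mat2) : Mat2 := ∫ ξ in (0 : ℝ)..1, S.K₁ ξ * M ξ

/-- `𝒦₂M = ∫₀¹ K₂ M`. -/
def matK₂ (M : ℝ → Mat2) : Mat2 := ∫ ξ in (0 : ℝ)..1, S.K₂ ξ * M ξ

/-- `𝒦₃M = ∫₀¹ K₃ M + K₄ M(1)`. -/
def matK₃ (M : ℝ → Mat2) : Mat2 := (∫ ξ in (0 : ℝ)..1, S.K₃ ξ * M ξ) + S.K₄ * M 1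

/-- The common domain of the operators `𝒜` and `𝒜_Σ(y)`: the `H¹` functions that vanish at `0`. -/
def domain : Set (ℝ → R2) := {ζ | MemH1 ζ ∧ ζ 0 = 0}

/-- `(𝒜ζ)(ξ) = -Λ ζ'(ξ) + 𝒦₃ζ`. -/
def opA (ζ : ℝ → R2) (ξ : ℝ) : R2 := -S.Λ.act (deriv ζ ξ) + S.opK₃ ζ

/-- `(𝒜_Σ(y)ζ)(ξ) = θ Σ(y) [ζ(ξ) + 𝒦₂ζ] + (𝒜ζ)(ξ)`. -/
def opASigma (y : R2) (ζ : ℝ → R2) (ξ : ℝ) : R2 :=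
  S.θ • (S.source y).act (ζ ξ + S.opK₂ ζ) + S.opA ζ ξ

/-- Strict dissipativity: `⟨𝒜ζ, 𝒬ζ⟩ ≤ -ω ‖ζ‖²` in `L²((0,1); ℝ²)` on the domain of `𝒜`, for some
`ω > 0`. -/
def StrictDissipativity : Prop :=
  ∃ ω : ℝ, 0 < ω ∧ ∀ ζ ∈ domain,
    ∫ ξ in (0 : ℝ)..1, ⟪S.opA ζ ξ, (S.Q ξ).act (ζ ξ)⟫ ≤ -ω * ∫ ξ in (0 : ℝ)..1, ‖ζ ξ‖ ^ 2

/-- Dissipativity and global Lipschitz continuity of the source matrix. -/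
def DissipativityAndLipschitz : Prop :=
  (∀ (y : R2) (ζ : ℝ → R2), MemL2 ζ →
    ∫ ξ in (0 : ℝ)..1, ⟪ζ ξ, (S.Q ξ).act ((S.source y).act (ζ ξ + S.opK₂ ζ))⟫ ≤ 0) ∧
  ∃ L : ℝ, 0 ≤ L ∧ ∀ y₁ y₂ : R2, ‖S.source y₁ - S.source y₂‖ ≤ L * ‖y₁ - y₂‖

open Classical in
/-- The inverse `𝒜_Σ(y)⁻¹`: it sends `f ∈ L²((0,1); ℝ²)` to the element `ζ` of the domain with
`𝒜_Σ(y)ζ = f` (and to `0` if there is none). -/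
def invASigma (y : R2) (f : ℝ → R2) : ℝ → R2 :=
  if h : ∃ ζ ∈ domain, S.opASigma y ζ =ᵐ[unitMeasure] f then h.choose else 0

/-- The matrix-valued function `𝒜_Σ(y)⁻¹H`: its columns are the images under `𝒜_Σ(y)⁻¹` of the
columns of `H`, seen as constant functions. -/
def invASigmaH (y : R2) (ξ : ℝ) : Mat2 :=
  Matrix.of fun i j => S.invASigma y (fun _ => S.H.column j) ξ i

/-- `Ψ(y) = -𝒦₁ 𝒜_Σ(y)⁻¹ H`. -/
def Ψ (y : R2) : Mat2 := -S.matK₁ (S.invASigmaH y)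

/-- `M ∈ C¹([0,1]; M₂(ℝ))` solves
`Λ M' = θ Σ(y) [M + 𝒦₂M] + 𝒦₃M + H Ψ(y)⁻¹` on `(0,1)`, with `M(0) = 0`. -/
structure IsSolution (y : R2) (M : ℝ → Mat2) : Prop where
  contDiffOn : ContDiffOn ℝ 1 M (Icc 0 1)
  equation : ∀ ξ ∈ Ioo (0 : ℝ) 1,
    S.Λ * deriv M ξ =
      S.θ • (S.source y * (M ξ + S.matK₂ M)) + S.matK₃ M + S.H * (S.Ψ y)⁻¹
  initial : M 0 = 0

end FrictionSystem

end

noncomputable section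

/-! ### Absolutely continuous functions -/

/-! Everything rests on one energy estimate. Pairing `𝒜_Σ(y)ζ` with `𝒬ζ` and using (i), (ii) and the
symmetry of `𝒬` gives `⟨𝒜_Σ(y)ζ, 𝒬ζ⟩ ≤ -ω‖ζ‖²`, so `ζ` vanishes as soon as the left side is
nonnegative (`eqOn_zero_of_integral_nonneg`). In particular `𝒜_Σ(y)` is injective.

Surjectivity is a Fredholm argument: the nonlocal terms contribute only a constant vector, so
`𝒜_Σ(y)` is a local ODE operator plus a finite-rank term. The local problem is solved by variation
of constants, and what remains is a linear map of the plane, where injectivity suffices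
(`exists_opASigma_eq`).

If `Ψ(y)v = 0`, then `ζ = 𝒜_Σ(y)⁻¹Hv` has `𝒦₁ζ = 0`. Since `𝒬H = K₁`, its energy is `⟨v, 𝒦₁ζ⟩ = 0`,
hence `ζ = 0`, `Hv = 0` and `v = 0` (`isUnit_Ψ`).

Tested on a vector `v`, the matrix problem reads `𝒜_Σ(y)(Mv) = -HΨ(y)⁻¹v`; bijectivity thus gives
existence, uniqueness and the formula, and the normalization is the definition of `Ψ`. -/

theorem IntervalIntegrable.absolutelyContinuousOnInterval_primitive {E : Type*}
    [NormedAddCommGroup E] [NormedSpace ℝ E] {f : ℝ → E} {a b : ℝ}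
    (hf : IntervalIntegrable f volume a b) :
    AbsolutelyContinuousOnInterval (fun x => ∫ t in a..x, f t) a b := by
  -- Increments of the primitive of `f` are dominated by those of the primitive of `‖f‖`, which
  -- reduces the claim to the real-valued case.
  have h := hf.norm.absolutelyContinuousOnInterval_intervalIntegral (c := a) (by simp)
  refine squeeze_zero' (Filter.Eventually.of_forall fun _ => Finset.sum_nonneg
    fun _ _ => dist_nonneg) ?_ h
  rw [Filter.eventually_inf_principal]
  filter_upwards with I hI
  refine Finset.sum_le_sum fun i hi => ?_
  have hmem := hI.1 i hi
  have h1 : IntervalIntegrable f volume a (I.2 i).1 :=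
    hf.mono_set (uIcc_subset_uIcc (by simp) hmem.1)
  have h2 : IntervalIntegrable f volume a (I.2 i).2 :=
    hf.mono_set (uIcc_subset_uIcc (by simp) hmem.2)
  rw [dist_comm, dist_comm (∫ t in a..(I.2 i).1, ‖f t‖), dist_eq_norm, dist_eq_norm,
    intervalIntegral.integral_interval_sub_left h2 h1,
    intervalIntegral.integral_interval_sub_left h2.norm h1.norm]
  exact intervalIntegral.norm_integral_le_abs_integral_norm

theorem uIcc_zero_one : uIcc (0 : ℝ) 1 = Icc 0 1 := uIcc_of_le zero_le_one

theorem ae_unitMeasure_mem : ∀ᵐ x ∂unitMeasure, x ∈ Ioo (0 : ℝ) 1 :=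
  ae_restrict_mem measurableSet_Ioo

theorem ae_unitMeasure_of_ae {p : ℝ → Prop} (h : ∀ᵐ x, x ∈ uIcc (0 : ℝ) 1 → p x) :
    ∀ᵐ x ∂unitMeasure, p x := by
  rw [ae_restrict_iff' measurableSet_Ioo]
  filter_upwards [h] with x hx hx'
  exact hx (uIcc_zero_one ▸ Ioo_subset_Icc_self hx')

theorem ae_of_ae_unitMeasure {p : ℝ → Prop} (h : ∀ᵐ x ∂unitMeasure, p x) :
    ∀ᵐ x, x ∈ uIcc (0 : ℝ) 1 → p x := by
  rw [ae_restrict_iff' measurableSet_Ioo] at h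
  have h0 : ∀ᵐ x : ℝ, x ≠ 0 := by simp [ae_iff, measure_singleton]
  have h1 : ∀ᵐ x : ℝ, x ≠ 1 := by simp [ae_iff, measure_singleton]
  filter_upwards [h, h0, h1] with x hx hx0 hx1 hmem
  rw [uIcc_zero_one] at hmem
  exact hx ⟨lt_of_le_of_ne hmem.1 hx0.symm, lt_of_le_of_ne hmem.2 hx1⟩

theorem integral_zero_one_eq {E : Type*} [NormedAddCommGroup E] [NormedSpace ℝ E] (f : ℝ → E) :
    ∫ x in (0 : ℝ)..1, f x = ∫ x, f x ∂unitMeasure := by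
  rw [intervalIntegral.integral_of_le zero_le_one, integral_Ioc_eq_integral_Ioo]

theorem integral_zero_one_congr_ae {E : Type*} [NormedAddCommGroup E] [NormedSpace ℝ E]
    {f g : ℝ → E} (h : f =ᵐ[unitMeasure] g) :
    ∫ x in (0 : ℝ)..1, f x = ∫ x in (0 : ℝ)..1, g x := by
  rw [integral_zero_one_eq, integral_zero_one_eq, integral_congr_ae h]

theorem intervalIntegrable_of_continuousOn_unit {E : Type*} [NormedAddCommGroup E]
    {f : ℝ → E} (h : ContinuousOn f (Icc 0 1)) : IntervalIntegrable f volume 0 1 :=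
  ContinuousOn.intervalIntegrable (uIcc_zero_one ▸ h)

/-! ### Square integrable functions -/

theorem ContinuousOn.memL2 {f : ℝ → R2} (h : ContinuousOn f (Icc 0 1)) : MemL2 f := by
  obtain ⟨C, hC⟩ := isCompact_Icc.exists_bound_of_continuousOn h
  refine MemLp.of_bound ((h.mono Ioo_subset_Icc_self).aestronglyMeasurable measurableSet_Ioo) C ?_
  filter_upwards [ae_unitMeasure_mem] with x hx using hC x (Ioo_subset_Icc_self hx)

theorem MemL2.add {f g : ℝ → R2} (hf : MemL2 f) (hg : MemL2 g) : MemL2 (fun x => f x + g x) :=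
  MemLp.add hf hg

theorem MemL2.map {f : ℝ → R2} (hf : MemL2 f) (A : R2 →L[ℝ] R2) : MemL2 (fun x => A (f x)) :=
  A.comp_memLp' hf

theorem MemL2.congr {f g : ℝ → R2} (hf : MemL2 f) (h : f =ᵐ[unitMeasure] g) : MemL2 g :=
  (memLp_congr_ae h).1 hf

theorem MemL2.const (c : R2) : MemL2 (fun _ => c) := continuousOn_const.memL2

theorem MemL2.intervalIntegrable {f : ℝ → R2} (hf : MemL2 f) :
    IntervalIntegrable f volume 0 1 := by
  rw [intervalIntegrable_iff_integrableOn_Ioo_of_le zero_le_one]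
  exact MemLp.integrable (by norm_num) hf

theorem MemL2.intervalIntegrable_inner {f g : ℝ → R2} (hf : MemL2 f)
    (hg : ContinuousOn g (Icc 0 1)) : IntervalIntegrable (fun x => ⟪f x, g x⟫) volume 0 1 := by
  have h : ∀ i : Fin 2, IntervalIntegrable (fun x => f x i * g x i) volume 0 1 := fun i => by
    refine IntervalIntegrable.mul_continuousOn ?_ ?_
    · have := hf.intervalIntegrable
      rw [intervalIntegrable_iff] at this ⊢
      exact (EuclideanSpace.proj (𝕜 := ℝ) i).integrable_comp this
    · rw [uIcc_zero_one]
      exact (EuclideanSpace.proj (𝕜 := ℝ) i).continuous.comp_continuousOn hg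
  refine ((h 0).add (h 1)).congr fun x _ => ?_
  simp [PiLp.inner_apply, Fin.sum_univ_two, mul_comm]

/-! ### The Sobolev space -/

theorem MemH1.continuousOn {ζ : ℝ → R2} (h : MemH1 ζ) : ContinuousOn ζ (Icc 0 1) :=
  uIcc_zero_one ▸ h.1.continuousOn

theorem MemH1.ae_differentiableAt {ζ : ℝ → R2} (h : MemH1 ζ) :
    ∀ᵐ x ∂unitMeasure, DifferentiableAt ℝ ζ x :=
  ae_unitMeasure_of_ae h.1.boundedVariationOn.ae_differentiableAt_of_mem_uIcc

theorem memH1_of_ae_hasDerivAt {ζ h : ℝ → R2} (hζ : AbsolutelyContinuousOnInterval ζ 0 1)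
    (hd : ∀ᵐ x ∂unitMeasure, HasDerivAt ζ (h x) x) (hh : MemL2 h) : MemH1 ζ :=
  ⟨hζ, hh.congr (by filter_upwards [hd] with x hx using hx.deriv.symm)⟩

theorem MemH1.add {ζ η : ℝ → R2} (hζ : MemH1 ζ) (hη : MemH1 η) : MemH1 (fun x => ζ x + η x) := by
  refine memH1_of_ae_hasDerivAt (hζ.1.fun_add hη.1) ?_ (hζ.2.add hη.2)
  filter_upwards [hζ.ae_differentiableAt, hη.ae_differentiableAt] with x h1 h2
  exact h1.hasDerivAt.fun_add h2.hasDerivAt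

theorem MemH1.const_smul {ζ : ℝ → R2} (hζ : MemH1 ζ) (c : ℝ) : MemH1 (fun x => c • ζ x) := by
  refine memH1_of_ae_hasDerivAt (hζ.1.const_smul c) ?_ (MemLp.const_smul hζ.2 c)
  filter_upwards [hζ.ae_differentiableAt] with x h1
  exact h1.hasDerivAt.fun_const_smul c

theorem ContDiffOn.memH1 {ζ : ℝ → R2} (h : ContDiffOn ℝ 1 ζ (Icc 0 1)) : MemH1 ζ := by
  refine memH1_of_ae_hasDerivAt (h := derivWithin ζ (Icc 0 1))
    (uIcc_zero_one ▸ h).absolutelyContinuousOnInterval ?_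
    (h.continuousOn_derivWithin (uniqueDiffOn_Icc zero_lt_one) le_rfl).memL2
  filter_upwards [ae_unitMeasure_mem] with x hx
  exact ((h.differentiableOn one_ne_zero) x (Ioo_subset_Icc_self hx)).hasDerivWithinAt.hasDerivAt
    (Icc_mem_nhds hx.1 hx.2)

/-- `ζ` minus a primitive of `h` is absolutely continuous with derivative zero almost everywhere,
hence constant. -/
theorem MemH1.contDiffOn_of_deriv_eq {ζ h : ℝ → R2} (hζ : MemH1 ζ)
    (hh : ContinuousOn h (Icc 0 1)) (hd : deriv ζ =ᵐ[unitMeasure] h) :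
    ContDiffOn ℝ 1 ζ (Icc 0 1) ∧ ∀ x ∈ Ioo (0 : ℝ) 1, deriv ζ x = h x := by
  -- Extending `h` continuously to the line makes the primitive `C¹` everywhere and avoids one-sided
  -- derivatives.
  set k : ℝ → R2 := IccExtend zero_le_one ((Icc (0 : ℝ) 1).domRestrict h) with hk
  have hkc : Continuous k := (continuousOn_iff_continuous_domRestrict.1 hh).Icc_extend'
  have hkh : ∀ x ∈ Icc (0 : ℝ) 1, k x = h x := fun x hx => by
    rw [hk, IccExtend_of_mem _ _ hx]; rfl
  set F : ℝ → R2 := fun x => ∫ t in (0 : ℝ)..x, k t with hF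
  have hFd : ∀ x, HasDerivAt F (k x) x := fun x => hkc.integral_hasStrictDerivAt 0 x |>.hasDerivAt
  have hFc : ContDiff ℝ 1 F :=
    contDiff_one_iff_deriv.2 ⟨fun x => (hFd x).differentiableAt, by
      rw [show deriv F = k from funext fun x => (hFd x).deriv]; exact hkc⟩
  obtain ⟨C, hC⟩ := (hζ.1.fun_sub
    (hFc.contDiffOn.absolutelyContinuousOnInterval)).const_of_ae_hasDerivAt_zero
    (ae_of_ae_unitMeasure (by
      filter_upwards [hζ.ae_differentiableAt, hd, ae_unitMeasure_mem] with x h1 h2 h3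
      have := h1.hasDerivAt.fun_sub (hFd x)
      rwa [h2, hkh x (Ioo_subset_Icc_self h3), sub_self] at this))
  rw [uIcc_zero_one] at hC
  have hEq : ∀ x ∈ Icc (0 : ℝ) 1, ζ x = F x + C := fun x hx => by
    rw [← hC x hx]; abel
  refine ⟨(hFc.add contDiff_const).contDiffOn.congr hEq, fun x hx => ?_⟩
  have : ζ =ᶠ[nhds x] fun x => F x + C := by
    filter_upwards [Icc_mem_nhds hx.1 hx.2] with z hz using hEq z hz
  rw [this.deriv_eq, ((hFd x).add_const C).deriv, hkh x (Ioo_subset_Icc_self hx)]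

/-- Solvability of the linear initial value problem `ζ' = Bζ + g`, `ζ(0) = 0`, in `H¹`. -/
theorem exists_memH1_deriv_eq (B : R2 →L[ℝ] R2) {g : ℝ → R2} (hg : MemL2 g) :
    ∃ ζ ∈ FrictionSystem.domain, ∀ᵐ x ∂unitMeasure, deriv ζ x = B (ζ x) + g x := by
  set g₀ : ℝ → R2 := (Ioo (0 : ℝ) 1).indicator g with hg₀
  have hgi : Integrable g₀ :=
    (integrable_indicator_iff measurableSet_Ioo).2 (MemLp.integrable (by norm_num) hg)
  -- With `ζ = w + G` the merely square integrable forcing is absorbed by `G`, and `w' = Bw + BG`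
  -- has continuous forcing.
  set G : ℝ → R2 := fun x => ∫ t in (0 : ℝ)..x, g₀ t with hG
  have hGc : Continuous G := intervalIntegral.continuous_primitive
    (fun a b => hgi.intervalIntegrable) 0
  have hGd : ∀ᵐ x ∂unitMeasure, HasDerivAt G (g x) x := by
    filter_upwards [ae_restrict_of_ae (LocallyIntegrable.ae_hasDerivAt_integral hgi.locallyIntegrable),
      ae_unitMeasure_mem] with x h1 h2
    have := h1 0
    rwa [hg₀, indicator_of_mem h2] at this
  have hexp : Continuous fun s : ℝ => NormedSpace.exp (s • -B) :=
    (differentiable_exp_smul_const ℝ (-B)).continuous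
  have hexpd := fun x : ℝ => hasDerivAt_exp_smul_const' (𝕂 := ℝ) B x
  have huc : Continuous fun s : ℝ => NormedSpace.exp (s • -B) (B (G s)) :=
    hexp.clm_apply (B.continuous.comp hGc)
  set u : ℝ → R2 := fun x => ∫ s in (0 : ℝ)..x, NormedSpace.exp (s • -B) (B (G s)) with hu
  have hud : ∀ x, HasDerivAt u (NormedSpace.exp (x • -B) (B (G x))) x := fun x =>
    (huc.integral_hasStrictDerivAt 0 x).hasDerivAt
  -- Variation of constants for `w`.
  set w : ℝ → R2 := fun x => NormedSpace.exp (x • B) (u x) with hw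
  have hwd : ∀ x, HasDerivAt w (B (w x) + B (G x)) x := fun x => by
    have h := (hexpd x).clm_apply (hud x)
    have hinv : NormedSpace.exp (x • B) * NormedSpace.exp (x • -B) = 1 := by
      let +nondep : NormedAlgebra ℚ (R2 →L[ℝ] R2) := .restrictScalars ℚ ℝ _
      have := NormedSpace.exp_add_of_commute (Commute.neg_right (Commute.refl (x • B)))
      rw [add_neg_cancel, NormedSpace.exp_zero] at this
      rw [smul_neg]
      exact this.symm
    have h2 : NormedSpace.exp (x • B) (NormedSpace.exp (x • -B) (B (G x))) = B (G x) := by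
      exact DFunLike.congr_fun hinv (B (G x))
    rw [h2] at h
    exact h
  have hwc : Continuous w := continuous_iff_continuousAt.2 fun x => (hwd x).continuousAt
  have hwC : ContDiff ℝ 1 w := contDiff_one_iff_deriv.2
    ⟨fun x => (hwd x).differentiableAt, by
      rw [show deriv w = fun x => B (w x) + B (G x) from funext fun x => (hwd x).deriv]
      fun_prop⟩
  have hd : ∀ᵐ x ∂unitMeasure,
      HasDerivAt (fun x => w x + G x) (B (w x + G x) + g x) x := by
    filter_upwards [hGd] with x hx
    rw [map_add]
    exact (hwd x).fun_add hx
  refine ⟨fun x => w x + G x, ⟨memH1_of_ae_hasDerivAt ?_ hd ?_, by simp [hw, hu, hG]⟩, ?_⟩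
  · exact hwC.contDiffOn.absolutelyContinuousOnInterval.fun_add
      hgi.intervalIntegrable.absolutelyContinuousOnInterval_primitive
  · exact ((hwc.add hGc).continuousOn.memL2.map B).add hg
  · filter_upwards [hd] with x hx using hx.deriv

/-! ### Matrices acting on the plane -/

namespace Mat2

/-- The action of a matrix, as a continuous linear map of the matrix. -/
def actL (v : R2) : Mat2 →L[ℝ] R2 :=
  LinearMap.toContinuousLinearMap
    { toFun := fun A => A.act v
      map_add' := fun A B => by simp [act]
      map_smul' := fun c A => by simp [act] }

theorem actL_apply (v : R2) (A : Mat2) : actL v A = A.act v := rfl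

theorem add_act (A B : Mat2) (v : R2) : act (A + B) v = A.act v + B.act v :=
  (actL v).map_add A B

theorem sub_act (A B : Mat2) (v : R2) : act (A - B) v = A.act v - B.act v :=
  (actL v).map_sub A B

theorem neg_act (A : Mat2) (v : R2) : act (-A) v = -A.act v :=
  (actL v).map_neg A

theorem smul_act (c : ℝ) (A : Mat2) (v : R2) : act (c • A) v = c • A.act v :=
  (actL v).map_smul c A

theorem zero_act (v : R2) : act 0 v = 0 :=
  (actL v).map_zero

theorem act_add (A : Mat2) (u v : R2) : A.act (u + v) = A.act u + A.act v :=
  map_add _ u v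

theorem act_neg (A : Mat2) (v : R2) : A.act (-v) = -A.act v :=
  map_neg _ v

theorem act_zero (A : Mat2) : A.act 0 = 0 :=
  map_zero _

theorem act_mul (A B : Mat2) (v : R2) : act (A * B) v = A.act (B.act v) := by
  simp [act]

theorem act_one (v : R2) : (1 : Mat2).act v = v := by
  simp [act]

theorem act_ext {A B : Mat2} (h : ∀ v, A.act v = B.act v) : A = B :=
  (Matrix.toEuclideanCLM (n := Fin 2) (𝕜 := ℝ)).injective (ContinuousLinearMap.ext h)

theorem inner_act_of_isSymm {A : Mat2} (hA : A.IsSymm) (u v : R2) :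
    ⟪u, A.act v⟫ = ⟪A.act u, v⟫ := by
  rw [real_inner_comm v, Matrix.inner_toEuclideanCLM, Matrix.inner_toEuclideanCLM,
    Matrix.dotProduct_mulVec, ← Matrix.mulVec_transpose, hA.eq, dotProduct_comm]

theorem isUnit_of_act_injective {A : Mat2} (h : ∀ v, A.act v = 0 → v = 0) : IsUnit A := by
  rw [← Matrix.mulVec_injective_iff_isUnit]
  refine (injective_iff_map_eq_zero A.mulVecLin).2 fun v hv => ?_
  have := h (WithLp.toLp 2 v) (by
    rw [act, Matrix.toEuclideanCLM_toLp]
    rw [Matrix.mulVecLin_apply] at hv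
    rw [hv]; rfl)
  simpa using congrArg WithLp.ofLp this

theorem act_eq_sum_column (A : Mat2) (v : R2) :
    A.act v = v 0 • A.column 0 + v 1 • A.column 1 := by
  ext i
  simp [act, column, Matrix.mulVec, dotProduct, Fin.sum_univ_two, mul_comm]

theorem continuousOn_act {A : ℝ → Mat2} {ζ : ℝ → R2} {s : Set ℝ} (hA : ContinuousOn A s)
    (hζ : ContinuousOn ζ s) : ContinuousOn (fun x => (A x).act (ζ x)) s := by
  have hL : Continuous fun B : Mat2 => Matrix.toEuclideanCLM (n := Fin 2) (𝕜 := ℝ) B :=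
    LinearMap.continuous_of_finiteDimensional
      (Matrix.toEuclideanCLM (n := Fin 2) (𝕜 := ℝ)).toAlgEquiv.toLinearMap
  exact (hL.comp_continuousOn hA).clm_apply hζ

/-- The matrix with `j`-th column `v` and zeros elsewhere, as a continuous linear map of `v`. -/
def ofColumnL (j : Fin 2) : R2 →L[ℝ] Mat2 :=
  LinearMap.toContinuousLinearMap
    { toFun := fun v => Matrix.of fun i k => if k = j then v i else 0
      map_add' := fun u v => by ext i k; by_cases h : k = j <;> simp [h]
      map_smul' := fun c v => by ext i k; by_cases h : k = j <;> simp [h] }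

theorem of_columns_eq (f : Fin 2 → R2) :
    (Matrix.of fun i j => f j i : Mat2) = ofColumnL 0 (f 0) + ofColumnL 1 (f 1) := by
  ext i j
  fin_cases j <;> simp [ofColumnL]

end Mat2

namespace FrictionSystem

variable (S : FrictionSystem)

theorem domain_continuousOn {ζ : ℝ → R2} (hζ : ζ ∈ domain) : ContinuousOn ζ (Icc 0 1) :=
  hζ.1.continuousOn

theorem domain_add {ζ η : ℝ → R2} (hζ : ζ ∈ domain) (hη : η ∈ domain) :
    (fun x => ζ x + η x) ∈ domain :=
  ⟨hζ.1.add hη.1, by simp [hζ.2, hη.2]⟩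

theorem domain_smul {ζ : ℝ → R2} (hζ : ζ ∈ domain) (c : ℝ) : (fun x => c • ζ x) ∈ domain :=
  ⟨hζ.1.const_smul c, by simp [hζ.2]⟩

/-! ### Linearity of the functionals and of the operator -/

theorem integral_act_add {K : ℝ → Mat2} (hK : ContinuousOn K (Icc 0 1)) {ζ η : ℝ → R2}
    (hζ : ContinuousOn ζ (Icc 0 1)) (hη : ContinuousOn η (Icc 0 1)) :
    ∫ ξ in (0 : ℝ)..1, (K ξ).act (ζ ξ + η ξ) =
      (∫ ξ in (0 : ℝ)..1, (K ξ).act (ζ ξ)) + ∫ ξ in (0 : ℝ)..1, (K ξ).act (η ξ) := by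
  rw [← intervalIntegral.integral_add
    (intervalIntegrable_of_continuousOn_unit (Mat2.continuousOn_act hK hζ))
    (intervalIntegrable_of_continuousOn_unit (Mat2.continuousOn_act hK hη))]
  simp only [map_add]

theorem integral_act_smul (K : ℝ → Mat2) (c : ℝ) (ζ : ℝ → R2) :
    ∫ ξ in (0 : ℝ)..1, (K ξ).act (c • ζ ξ) = c • ∫ ξ in (0 : ℝ)..1, (K ξ).act (ζ ξ) := by
  rw [← intervalIntegral.integral_smul]
  simp only [map_smul]

theorem integral_act_congr (K : ℝ → Mat2) {ζ η : ℝ → R2} (h : EqOn ζ η (Icc 0 1)) :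
    ∫ ξ in (0 : ℝ)..1, (K ξ).act (ζ ξ) = ∫ ξ in (0 : ℝ)..1, (K ξ).act (η ξ) := by
  refine intervalIntegral.integral_congr fun x hx => ?_
  rw [uIcc_zero_one] at hx
  simp only [h hx]

/-- The part `θ Σ(y) 𝒦₂ζ + 𝒦₃ζ` of `𝒜_Σ(y)ζ` that is constant in `ξ`. -/
def nonlocalPart (y : R2) (ζ : ℝ → R2) : R2 :=
  S.θ • (S.source y).act (S.opK₂ ζ) + S.opK₃ ζ

theorem opASigma_eq (y : R2) (ζ : ℝ → R2) (ξ : ℝ) :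
    S.opASigma y ζ ξ =
      S.θ • (S.source y).act (ζ ξ) - S.Λ.act (deriv ζ ξ) + S.nonlocalPart y ζ := by
  simp only [opASigma, opA, nonlocalPart, map_add, smul_add]
  abel

theorem nonlocalPart_add (y : R2) {ζ η : ℝ → R2} (hζ : ContinuousOn ζ (Icc 0 1))
    (hη : ContinuousOn η (Icc 0 1)) :
    S.nonlocalPart y (fun x => ζ x + η x) = S.nonlocalPart y ζ + S.nonlocalPart y η := by
  have h2 := integral_act_add S.K₂_continuousOn hζ hη
  have h3 := integral_act_add S.K₃_continuousOn hζ hη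
  simp only [nonlocalPart, opK₂, opK₃]
  rw [h2, h3]
  simp only [map_add, smul_add]
  abel

theorem nonlocalPart_smul (y : R2) (c : ℝ) (ζ : ℝ → R2) :
    S.nonlocalPart y (fun x => c • ζ x) = c • S.nonlocalPart y ζ := by
  simp only [nonlocalPart, opK₂, opK₃]
  rw [integral_act_smul, integral_act_smul]
  simp only [map_smul, smul_add, smul_comm c S.θ]

theorem nonlocalPart_congr (y : R2) {ζ η : ℝ → R2} (h : EqOn ζ η (Icc 0 1)) :
    S.nonlocalPart y ζ = S.nonlocalPart y η := by
  simp only [nonlocalPart, opK₂, opK₃, integral_act_congr _ h, h (right_mem_Icc.2 zero_le_one)]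

theorem nonlocalPart_of_eqOn_zero (y : R2) {ζ : ℝ → R2} (h : EqOn ζ 0 (Icc 0 1)) :
    S.nonlocalPart y ζ = 0 := by
  have h0 := S.nonlocalPart_smul y 0 ζ
  rw [zero_smul] at h0
  rw [← h0]
  exact S.nonlocalPart_congr y fun x hx => by simp [h hx]

theorem opASigma_add (y : R2) {ζ η : ℝ → R2} (hζ : ζ ∈ domain) (hη : η ∈ domain) :
    S.opASigma y (fun x => ζ x + η x) =ᵐ[unitMeasure]
      fun x => S.opASigma y ζ x + S.opASigma y η x := by
  filter_upwards [hζ.1.ae_differentiableAt, hη.1.ae_differentiableAt] with x h1 h2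
  simp only [opASigma_eq, deriv_fun_add h1 h2,
    S.nonlocalPart_add y (domain_continuousOn hζ) (domain_continuousOn hη), map_add, smul_add]
  abel

theorem opASigma_smul (y : R2) (c : ℝ) {ζ : ℝ → R2} (hζ : ζ ∈ domain) :
    S.opASigma y (fun x => c • ζ x) =ᵐ[unitMeasure] fun x => c • S.opASigma y ζ x := by
  filter_upwards [hζ.1.ae_differentiableAt] with x h1
  simp only [opASigma_eq, deriv_fun_const_smul c h1, S.nonlocalPart_smul, map_smul, smul_add,
    smul_sub, smul_comm c S.θ]

theorem opASigma_of_eqOn_zero (y : R2) {ζ : ℝ → R2} (h : EqOn ζ 0 (Icc 0 1)) {x : ℝ}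
    (hx : x ∈ Ioo (0 : ℝ) 1) : S.opASigma y ζ x = 0 := by
  have hd : deriv ζ x = 0 := by
    have : ζ =ᶠ[nhds x] fun _ => 0 := by
      filter_upwards [Icc_mem_nhds hx.1 hx.2] with z hz using h hz
    rw [this.deriv_eq, deriv_const]
  rw [opASigma_eq, hd, h (Ioo_subset_Icc_self hx), S.nonlocalPart_of_eqOn_zero y h]
  simp

theorem memL2_opASigma (y : R2) {ζ : ℝ → R2} (hζ : ζ ∈ domain) : MemL2 (S.opASigma y ζ) := by
  have h1 := (domain_continuousOn hζ).memL2.map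
    (S.θ • Matrix.toEuclideanCLM (n := Fin 2) (𝕜 := ℝ) (S.source y))
  have h2 := hζ.1.2.map (-Matrix.toEuclideanCLM (n := Fin 2) (𝕜 := ℝ) S.Λ)
  refine ((h1.add h2).add (MemL2.const (S.nonlocalPart y ζ))).congr (ae_of_all _ fun x => ?_)
  rw [opASigma_eq]
  simp [sub_eq_add_neg]

/-! ### Dissipativity and injectivity -/

theorem Q_isSymm {ξ : ℝ} (hξ : ξ ∈ Icc (0 : ℝ) 1) : (S.Q ξ).IsSymm := by
  have := (S.weight_posDef ξ hξ).isHermitian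
  rwa [Matrix.IsHermitian, Matrix.conjTranspose_eq_transpose_of_trivial] at this

theorem Q_continuousOn : ContinuousOn S.Q (Icc 0 1) :=
  S.K₁_continuousOn.mul continuousOn_const

theorem inv_H_mul_H : S.H⁻¹ * S.H = 1 :=
  Matrix.nonsing_inv_mul _ ((Matrix.isUnit_iff_isUnit_det _).1 S.H_isUnit)

theorem Λ_mul_inv : S.Λ * S.Λ⁻¹ = 1 :=
  Matrix.mul_nonsing_inv _ ((Matrix.isUnit_iff_isUnit_det _).1 S.Λ_posDef.isUnit)

theorem inv_Λ_mul : S.Λ⁻¹ * S.Λ = 1 :=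
  Matrix.nonsing_inv_mul _ ((Matrix.isUnit_iff_isUnit_det _).1 S.Λ_posDef.isUnit)

/-- Both `𝒬` and `K₁` are symmetric and `𝒬H = K₁`. -/
theorem inner_H_Q {ξ : ℝ} (hξ : ξ ∈ Icc (0 : ℝ) 1) (u v : R2) :
    ⟪S.H.act u, (S.Q ξ).act v⟫ = ⟪u, (S.K₁ ξ).act v⟫ := by
  rw [Mat2.inner_act_of_isSymm (S.Q_isSymm hξ), ← Mat2.act_mul, FrictionSystem.Q, mul_assoc, S.inv_H_mul_H,
    mul_one, Mat2.inner_act_of_isSymm (S.K₁_isSymm ξ hξ)]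

variable {S}

/-- The operator `𝒜_Σ(y)` inherits strict dissipativity: an element of the domain on which its
quadratic form is nonnegative vanishes. -/
theorem eqOn_zero_of_integral_nonneg (h₁ : S.StrictDissipativity)
    (h₂ : S.DissipativityAndLipschitz) (y : R2) {ζ : ℝ → R2} (hζ : ζ ∈ domain)
    (h : 0 ≤ ∫ ξ in (0 : ℝ)..1, ⟪S.opASigma y ζ ξ, (S.Q ξ).act (ζ ξ)⟫) :
    EqOn ζ 0 (Icc 0 1) := by
  obtain ⟨ω, hω, hdis⟩ := h₁
  have hc := domain_continuousOn hζ
  have hQζ := Mat2.continuousOn_act S.Q_continuousOn hc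
  have hsrc : ContinuousOn
      (fun ξ => (S.source y).act (ζ ξ + S.opK₂ ζ)) (Icc 0 1) :=
    (Matrix.toEuclideanCLM (n := Fin 2) (𝕜 := ℝ) (S.source y)).continuous.comp_continuousOn
      (hc.add continuousOn_const)
  have hA : MemL2 (S.opA ζ) :=
    ((hζ.1.2.map (-Matrix.toEuclideanCLM (n := Fin 2) (𝕜 := ℝ) S.Λ)).add
      (MemL2.const (S.opK₃ ζ))).congr (ae_of_all _ fun x => by simp [opA])
  -- Symmetry of `𝒬` puts the source term in the form of the dissipativity hypothesis.
  have hsplit : ∫ ξ in (0 : ℝ)..1, ⟪S.opASigma y ζ ξ, (S.Q ξ).act (ζ ξ)⟫ =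
      S.θ * (∫ ξ in (0 : ℝ)..1, ⟪ζ ξ, (S.Q ξ).act ((S.source y).act (ζ ξ + S.opK₂ ζ))⟫) +
        ∫ ξ in (0 : ℝ)..1, ⟪S.opA ζ ξ, (S.Q ξ).act (ζ ξ)⟫ := by
    rw [← intervalIntegral.integral_const_mul, ← intervalIntegral.integral_add
      ((hc.memL2.intervalIntegrable_inner
        (Mat2.continuousOn_act S.Q_continuousOn hsrc)).const_mul S.θ)
      (hA.intervalIntegrable_inner hQζ)]
    refine intervalIntegral.integral_congr fun x hx => ?_
    rw [uIcc_zero_one] at hx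
    simp only [opASigma, inner_add_left, real_inner_smul_left]
    rw [Mat2.inner_act_of_isSymm (S.Q_isSymm hx) (ζ x), real_inner_comm (Mat2.act _ (ζ x))]
  have hsq : ∫ ξ in (0 : ℝ)..1, ‖ζ ξ‖ ^ 2 ≤ 0 := by
    have h3 := hdis ζ hζ
    have h4 := mul_nonpos_of_nonneg_of_nonpos S.θ_nonneg (h₂.1 y ζ hc.memL2)
    nlinarith
  -- A continuous function with zero `L²` norm vanishes at every point, endpoints included.
  by_contra hne
  obtain ⟨x, hx, hxne⟩ : ∃ x ∈ Icc (0 : ℝ) 1, ζ x ≠ 0 := by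
    simpa [EqOn, and_assoc] using hne
  exact absurd hsq (not_le.2 (intervalIntegral.integral_pos zero_lt_one (hc.norm.pow 2)
    (fun _ _ => by positivity) ⟨x, hx, by positivity⟩))

theorem eqOn_zero_of_opASigma_eq_zero (h₁ : S.StrictDissipativity)
    (h₂ : S.DissipativityAndLipschitz) (y : R2) {ζ : ℝ → R2} (hζ : ζ ∈ domain)
    (h : S.opASigma y ζ =ᵐ[unitMeasure] 0) : EqOn ζ 0 (Icc 0 1) := by
  refine eqOn_zero_of_integral_nonneg h₁ h₂ y hζ (le_of_eq ?_)
  rw [integral_zero_one_congr_ae (g := fun _ => 0)]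
  · simp
  · filter_upwards [h] with x hx
    simp [hx]

theorem eqOn_of_opASigma_eq (h₁ : S.StrictDissipativity)
    (h₂ : S.DissipativityAndLipschitz) (y : R2) {ζ η : ℝ → R2} (hζ : ζ ∈ domain)
    (hη : η ∈ domain) (h : S.opASigma y ζ =ᵐ[unitMeasure] S.opASigma y η) :
    EqOn ζ η (Icc 0 1) := by
  have hη' := domain_smul hη (-1)
  have h0 := eqOn_zero_of_opASigma_eq_zero h₁ h₂ y (domain_add hζ hη') (by
    filter_upwards [S.opASigma_add y hζ hη', S.opASigma_smul y (-1) hη, h] with x h3 h4 h5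
    rw [h3, h4, h5]
    simp)
  intro x hx
  have := h0 hx
  simpa [← sub_eq_add_neg, sub_eq_zero] using this

/-! ### Surjectivity -/

variable (S) in
/-- Solvability of the equation with the nonlocal terms removed. -/
theorem exists_local_solution (y : R2) {f : ℝ → R2} (hf : MemL2 f) :
    ∃ ζ ∈ domain, ∀ᵐ x ∂unitMeasure, S.opASigma y ζ x = f x + S.nonlocalPart y ζ := by
  obtain ⟨ζ, hζ, hd⟩ := exists_memH1_deriv_eq
    (S.θ • Matrix.toEuclideanCLM (n := Fin 2) (𝕜 := ℝ) (S.Λ⁻¹ * S.source y))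
    (hf.map (-Matrix.toEuclideanCLM (n := Fin 2) (𝕜 := ℝ) S.Λ⁻¹))
  refine ⟨ζ, hζ, ?_⟩
  filter_upwards [hd] with x hx
  have hΛ : ∀ v, S.Λ.act (Mat2.act S.Λ⁻¹ v) = v := fun v => by
    rw [← Mat2.act_mul, S.Λ_mul_inv, Mat2.act_one]
  have hx' : deriv ζ x = S.θ • Mat2.act S.Λ⁻¹ ((S.source y).act (ζ x)) - Mat2.act S.Λ⁻¹ (f x) := by
    rw [hx, map_mul]
    simp [sub_eq_add_neg]
  have hx'' : S.Λ.act (deriv ζ x) = S.θ • (S.source y).act (ζ x) - f x := by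
    rw [hx']
    simp only [map_sub, map_smul, hΛ]
  rw [opASigma_eq, hx'']
  abel

/-- A local solution misses the target only by a constant vector. Local solutions with constant data
form a two-parameter family `P c`, and a suitable `c` corrects the error. -/
theorem exists_opASigma_eq (h₁ : S.StrictDissipativity) (h₂ : S.DissipativityAndLipschitz)
    (y : R2) {f : ℝ → R2} (hf : MemL2 f) :
    ∃ ζ ∈ domain, S.opASigma y ζ =ᵐ[unitMeasure] f := by
  choose φ hφ hφeq using fun j : Fin 2 =>
    S.exists_local_solution y (MemL2.const (EuclideanSpace.single j (1 : ℝ)))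
  set P : R2 → ℝ → R2 := fun c x => c 0 • φ 0 x + c 1 • φ 1 x with hP
  have hPdom : ∀ c, P c ∈ domain := fun c =>
    domain_add (domain_smul (hφ 0) _) (domain_smul (hφ 1) _)
  have hPnl : ∀ c, S.nonlocalPart y (P c) =
      c 0 • S.nonlocalPart y (φ 0) + c 1 • S.nonlocalPart y (φ 1) := fun c => by
    rw [hP, S.nonlocalPart_add y (domain_continuousOn (domain_smul (hφ 0) _))
      (domain_continuousOn (domain_smul (hφ 1) _)), nonlocalPart_smul, nonlocalPart_smul]
  have hPeq : ∀ c, ∀ᵐ x ∂unitMeasure,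
      S.opASigma y (P c) x = c + S.nonlocalPart y (P c) := fun c => by
    filter_upwards [S.opASigma_add y (domain_smul (hφ 0) (c 0)) (domain_smul (hφ 1) (c 1)),
      S.opASigma_smul y (c 0) (hφ 0), S.opASigma_smul y (c 1) (hφ 1), hφeq 0, hφeq 1]
      with x h1 h2 h3 h4 h5
    have hc : c = c 0 • EuclideanSpace.single 0 (1 : ℝ) + c 1 • EuclideanSpace.single 1 1 := by
      ext i
      fin_cases i <;> simp
    rw [hPnl]
    nth_rw 2 [hc]
    refine h1.trans ?_
    rw [h2, h3, h4, h5, smul_add, smul_add]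
    abel
  -- `T c` is the constant value of `𝒜_Σ(y)(P c)`. If it is zero, then `P c = 0` by dissipativity,
  -- its nonlocal part vanishes, and `c = 0`.
  let T : R2 →ₗ[ℝ] R2 :=
    { toFun := fun c => c + S.nonlocalPart y (P c)
      map_add' := fun c d => by
        simp only [hPnl, PiLp.add_apply, add_smul]
        abel
      map_smul' := fun r c => by
        simp only [hPnl, PiLp.smul_apply, smul_eq_mul, mul_smul, smul_add, RingHom.id_apply] }
  have hTinj : Function.Injective T := by
    refine (injective_iff_map_eq_zero T).2 fun c hc => ?_
    have hc' : c + S.nonlocalPart y (P c) = 0 := hc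
    have h0 := eqOn_zero_of_opASigma_eq_zero h₁ h₂ y (hPdom c) (by
      filter_upwards [hPeq c] with x hx
      rw [hx, hc']
      rfl)
    rwa [S.nonlocalPart_of_eqOn_zero y h0, add_zero] at hc'
  obtain ⟨η, hη, hηeq⟩ := S.exists_local_solution y hf
  -- Choose `c` to cancel the constant error left by `η`.
  obtain ⟨c, hc⟩ := (LinearMap.injective_iff_surjective.1 hTinj) (-S.nonlocalPart y η)
  have hc' : c + S.nonlocalPart y (P c) = -S.nonlocalPart y η := hc
  refine ⟨_, domain_add hη (hPdom c), ?_⟩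
  filter_upwards [S.opASigma_add y hη (hPdom c), hηeq, hPeq c] with x h3 h4 h5
  rw [h3, h4, h5, hc']
  abel

end FrictionSystem

namespace FrictionSystem

/-! ### Regularity for constant data -/

variable {S : FrictionSystem}

-- Solving the equation for `ζ'` shows that it agrees almost everywhere with a continuous function.
-- This yields the `C¹` regularity of `M` and allows evaluation at individual points.
variable (S) in
theorem contDiffOn_of_opASigma_eq_const (y : R2) {ζ : ℝ → R2} (hζ : ζ ∈ domain) {f : R2}
    (h : S.opASigma y ζ =ᵐ[unitMeasure] fun _ => f) :
    ContDiffOn ℝ 1 ζ (Icc 0 1) ∧ ∀ x ∈ Ioo (0 : ℝ) 1, S.opASigma y ζ x = f := by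
  set k : ℝ → R2 := fun x =>
    Mat2.act S.Λ⁻¹ (S.θ • (S.source y).act (ζ x) + S.nonlocalPart y ζ - f) with hk
  have hc := domain_continuousOn hζ
  have hkc : ContinuousOn k (Icc 0 1) := by
    simp only [hk]
    fun_prop
  obtain ⟨hC, hd⟩ := hζ.1.contDiffOn_of_deriv_eq hkc (by
    filter_upwards [h] with x hx
    rw [opASigma_eq] at hx
    have : S.Λ.act (deriv ζ x) = S.θ • (S.source y).act (ζ x) + S.nonlocalPart y ζ - f := by
      rw [← hx]
      abel
    rw [hk]
    beta_reduce
    rw [← this, ← Mat2.act_mul, S.inv_Λ_mul, Mat2.act_one])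
  refine ⟨hC, fun x hx => ?_⟩
  rw [opASigma_eq, hd x hx, hk]
  beta_reduce
  rw [← Mat2.act_mul, S.Λ_mul_inv, Mat2.act_one]
  abel

/-! ### The inverse operator -/

theorem invASigma_spec (h₁ : S.StrictDissipativity) (h₂ : S.DissipativityAndLipschitz)
    (y : R2) {f : ℝ → R2} (hf : MemL2 f) :
    S.invASigma y f ∈ domain ∧ S.opASigma y (S.invASigma y f) =ᵐ[unitMeasure] f := by
  have h := exists_opASigma_eq h₁ h₂ y hf
  rw [invASigma, dif_pos h]
  exact h.choose_spec

theorem column_invASigmaH (y : R2) (x : ℝ) (j : Fin 2) :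
    (S.invASigmaH y x).column j = S.invASigma y (fun _ => S.H.column j) x := rfl

theorem invASigmaH_act_spec (h₁ : S.StrictDissipativity) (h₂ : S.DissipativityAndLipschitz)
    (y v : R2) : (fun x => (S.invASigmaH y x).act v) ∈ domain ∧
      S.opASigma y (fun x => (S.invASigmaH y x).act v) =ᵐ[unitMeasure] fun _ => S.H.act v := by
  have hj := fun j => invASigma_spec h₁ h₂ y (MemL2.const (S.H.column j))
  simp only [Mat2.act_eq_sum_column, column_invASigmaH]
  refine ⟨domain_add (domain_smul (hj 0).1 _) (domain_smul (hj 1).1 _), ?_⟩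
  filter_upwards [S.opASigma_add y (domain_smul (hj 0).1 (v 0)) (domain_smul (hj 1).1 (v 1)),
    S.opASigma_smul y (v 0) (hj 0).1, S.opASigma_smul y (v 1) (hj 1).1, (hj 0).2, (hj 1).2]
    with x h3 h4 h5 h6 h7
  rw [h3, h4, h5, h6, h7]

theorem contDiffOn_invASigmaH (h₁ : S.StrictDissipativity) (h₂ : S.DissipativityAndLipschitz)
    (y : R2) : ContDiffOn ℝ 1 (S.invASigmaH y) (Icc 0 1) := by
  have hj := fun j => invASigma_spec h₁ h₂ y (MemL2.const (S.H.column j))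
  have hC := fun j => (S.contDiffOn_of_opASigma_eq_const y (hj j).1 (hj j).2).1
  refine (((Mat2.ofColumnL 0).contDiff.comp_contDiffOn (hC 0)).add
    ((Mat2.ofColumnL 1).contDiff.comp_contDiffOn (hC 1))).congr fun x _ => ?_
  exact Mat2.of_columns_eq fun j => S.invASigma y (fun _ => S.H.column j) x

/-! ### The functionals on matrix-valued functions -/

theorem integral_mul_act {K M : ℝ → Mat2} (hK : ContinuousOn K (Icc 0 1))
    (hM : ContinuousOn M (Icc 0 1)) (v : R2) :
    Mat2.act (∫ ξ in (0 : ℝ)..1, K ξ * M ξ) v = ∫ ξ in (0 : ℝ)..1, (K ξ).act ((M ξ).act v) := by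
  have hKM : ContinuousOn (fun ξ => K ξ * M ξ) (Icc 0 1) := hK.mul hM
  rw [← Mat2.actL_apply, ← (Mat2.actL v).intervalIntegral_comp_comm
    (intervalIntegrable_of_continuousOn_unit hKM)]
  simp only [Mat2.actL_apply, Mat2.act_mul]

theorem matK₁_act {M : ℝ → Mat2} (hM : ContinuousOn M (Icc 0 1)) (v : R2) :
    (S.matK₁ M).act v = S.opK₁ fun x => (M x).act v :=
  integral_mul_act S.K₁_continuousOn hM v

theorem matK₂_act {M : ℝ → Mat2} (hM : ContinuousOn M (Icc 0 1)) (v : R2) :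
    (S.matK₂ M).act v = S.opK₂ fun x => (M x).act v :=
  integral_mul_act S.K₂_continuousOn hM v

theorem matK₃_act {M : ℝ → Mat2} (hM : ContinuousOn M (Icc 0 1)) (v : R2) :
    (S.matK₃ M).act v = S.opK₃ fun x => (M x).act v := by
  have h := integral_mul_act S.K₃_continuousOn hM v
  rw [matK₃, opK₃, ← h, ← Mat2.act_mul, Mat2.add_act]

theorem matK₁_mul {M : ℝ → Mat2} (hM : ContinuousOn M (Icc 0 1)) (A : Mat2) :
    S.matK₁ (fun x => M x * A) = S.matK₁ M * A := by
  refine Mat2.act_ext fun v => ?_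
  have hMA : ContinuousOn (fun x => M x * A) (Icc 0 1) := hM.mul continuousOn_const
  rw [Mat2.act_mul, matK₁_act hMA, matK₁_act hM]
  simp only [Mat2.act_mul]

/-- When `𝒜_Σ(y)ζ = Hv`, the right side is the energy of `ζ`; this links `Ψ` to dissipativity. -/
theorem inner_opK₁ {ζ : ℝ → R2} (hζ : ContinuousOn ζ (Icc 0 1)) (v : R2) :
    ⟪v, S.opK₁ ζ⟫ = ∫ ξ in (0 : ℝ)..1, ⟪S.H.act v, (S.Q ξ).act (ζ ξ)⟫ := by
  rw [opK₁, ← innerSL_apply_apply ℝ v, ← (innerSL ℝ v).intervalIntegral_comp_comm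
    (intervalIntegrable_of_continuousOn_unit (Mat2.continuousOn_act S.K₁_continuousOn hζ))]
  refine intervalIntegral.integral_congr fun x hx => ?_
  rw [uIcc_zero_one] at hx
  exact (S.inner_H_Q hx v (ζ x)).symm

theorem isUnit_Ψ (h₁ : S.StrictDissipativity) (h₂ : S.DissipativityAndLipschitz) (y : R2) :
    IsUnit (S.Ψ y) := by
  refine Mat2.isUnit_of_act_injective fun v hv => ?_
  obtain ⟨hdom, heq⟩ := invASigmaH_act_spec h₁ h₂ y v
  have hK : S.opK₁ (fun x => (S.invASigmaH y x).act v) = 0 := by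
    rw [← matK₁_act (contDiffOn_invASigmaH h₁ h₂ y).continuousOn]
    rwa [Ψ, Mat2.neg_act, neg_eq_zero] at hv
  have h0 := eqOn_zero_of_integral_nonneg h₁ h₂ y hdom (le_of_eq (by
    rw [integral_zero_one_congr_ae (g := fun ξ =>
      ⟪S.H.act v, (S.Q ξ).act ((S.invASigmaH y ξ).act v)⟫) (by
        filter_upwards [heq] with x hx
        rw [hx]), ← inner_opK₁ (domain_continuousOn hdom), hK, inner_zero_right]))
  -- The equation holds at every interior point, so it can be read off at any one of them.
  have hH : S.H.act v = 0 := by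
    have hhalf : (1 / 2 : ℝ) ∈ Ioo (0 : ℝ) 1 := by norm_num
    rw [← (S.contDiffOn_of_opASigma_eq_const y hdom heq).2 _ hhalf]
    exact S.opASigma_of_eqOn_zero y h0 hhalf
  rw [← Mat2.act_one v, ← S.inv_H_mul_H, Mat2.act_mul, hH, Mat2.act_zero]

/-! ### The nonlocal matrix problem -/

/-- The matrix equation, tested against vectors, is the equation `𝒜_Σ(y)(Mv) = -HΨ(y)⁻¹v`. -/
theorem opASigma_act_eq_iff (y : R2) {M : ℝ → Mat2} (hM : ContDiffOn ℝ 1 M (Icc 0 1)) (A : Mat2)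
    {x : ℝ} (hx : x ∈ Ioo (0 : ℝ) 1) :
    S.Λ * deriv M x = S.θ • (S.source y * (M x + S.matK₂ M)) + S.matK₃ M + A ↔
      ∀ v, S.opASigma y (fun x => (M x).act v) x = -A.act v := by
  have hMd : DifferentiableAt ℝ M x :=
    (hM.differentiableOn one_ne_zero).differentiableAt (Icc_mem_nhds hx.1 hx.2)
  have hd : ∀ v, deriv (fun x => (M x).act v) x = (deriv M x).act v := fun v =>
    ((Mat2.actL v).hasFDerivAt.comp_hasDerivAt x hMd.hasDerivAt).deriv
  have key : ∀ v, S.opASigma y (fun x => (M x).act v) x =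
      Mat2.act (S.θ • (S.source y * (M x + S.matK₂ M)) + S.matK₃ M - S.Λ * deriv M x) v := by
    intro v
    rw [opASigma, opA, hd, ← matK₂_act hM.continuousOn, ← matK₃_act hM.continuousOn]
    simp only [Mat2.sub_act, Mat2.add_act, Mat2.smul_act, Mat2.act_mul, Mat2.act_add]
    abel
  simp only [key]
  constructor
  · intro h v
    rw [h, sub_add_cancel_left, Mat2.neg_act]
  · intro h
    have : S.θ • (S.source y * (M x + S.matK₂ M)) + S.matK₃ M - S.Λ * deriv M x = -A :=
      Mat2.act_ext fun v => by rw [h v, Mat2.neg_act]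
    rw [sub_eq_iff_eq_add] at this
    rw [this]
    abel

theorem IsSolution.act_mem_domain {y : R2} {M : ℝ → Mat2} (hM : S.IsSolution y M) (v : R2) :
    (fun x => (M x).act v) ∈ domain :=
  ⟨((Mat2.actL v).contDiff.comp_contDiffOn hM.contDiffOn).memH1, by
    beta_reduce
    rw [hM.initial, Mat2.zero_act]⟩

theorem IsSolution.eqOn (h₁ : S.StrictDissipativity) (h₂ : S.DissipativityAndLipschitz)
    {y : R2} {M N : ℝ → Mat2} (hM : S.IsSolution y M) (hN : S.IsSolution y N) :
    EqOn M N (Icc 0 1) := by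
  refine fun x hx => Mat2.act_ext fun v => ?_
  refine eqOn_of_opASigma_eq h₁ h₂ y (hM.act_mem_domain v) (hN.act_mem_domain v) ?_ hx
  filter_upwards [ae_unitMeasure_mem] with z hz
  rw [(opASigma_act_eq_iff y hM.contDiffOn _ hz).1 (hM.equation z hz) v,
    (opASigma_act_eq_iff y hN.contDiffOn _ hz).1 (hN.equation z hz) v]

theorem isSolution_neg_invASigmaH (h₁ : S.StrictDissipativity)
    (h₂ : S.DissipativityAndLipschitz) (y : R2) :
    S.IsSolution y fun x => -(S.invASigmaH y x * (S.Ψ y)⁻¹) := by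
  have hC := contDiffOn_invASigmaH h₁ h₂ y
  have hMC : ContDiffOn ℝ 1 (fun x => -(S.invASigmaH y x * (S.Ψ y)⁻¹)) (Icc 0 1) :=
    (hC.mul contDiffOn_const).neg
  refine ⟨hMC, fun x hx => ?_, ?_⟩
  · rw [opASigma_act_eq_iff y hMC _ hx]
    intro v
    -- Applied to `v`, the candidate is `𝒜_Σ(y)⁻¹H` applied to `-Ψ(y)⁻¹v`.
    obtain ⟨hdom, heq⟩ := invASigmaH_act_spec h₁ h₂ y (-Mat2.act (S.Ψ y)⁻¹ v)
    rw [show (fun x => Mat2.act (-(S.invASigmaH y x * (S.Ψ y)⁻¹)) v) =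
      fun x => (S.invASigmaH y x).act (-Mat2.act (S.Ψ y)⁻¹ v) from
        funext fun x => by rw [Mat2.neg_act, Mat2.act_mul, Mat2.act_neg]]
    rw [(S.contDiffOn_of_opASigma_eq_const y hdom heq).2 x hx, Mat2.act_neg, Mat2.act_mul]
  · refine Mat2.act_ext fun v => ?_
    have := (invASigmaH_act_spec h₁ h₂ y (-Mat2.act (S.Ψ y)⁻¹ v)).1.2
    rw [Mat2.neg_act, Mat2.act_mul, Mat2.zero_act, ← this]
    exact (Mat2.act_neg _ _).symm

/-- The constant right factor leaves the integral, and what remains is `Ψ(y)Ψ(y)⁻¹`. -/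
theorem matK₁_neg_invASigmaH (h₁ : S.StrictDissipativity)
    (h₂ : S.DissipativityAndLipschitz) (y : R2) :
    S.matK₁ (fun x => -(S.invASigmaH y x * (S.Ψ y)⁻¹)) = 1 := by
  have hC := (contDiffOn_invASigmaH h₁ h₂ y).continuousOn
  simp only [← mul_neg]
  rw [matK₁_mul hC, mul_neg, ← neg_mul]
  exact Matrix.mul_nonsing_inv _ ((Matrix.isUnit_iff_isUnit_det _).1 (isUnit_Ψ h₁ h₂ y))

end FrictionSystem

end

theorem mainTheorem4 (S : FrictionSystem)
    (h₁ : S.StrictDissipativity) (h₂ : S.DissipativityAndLipschitz) (y : R2) :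
    -- `𝒜_Σ(y)` is a bijection from its domain onto `L²((0,1); ℝ²)`
    ((∀ ζ ∈ FrictionSystem.domain, MemL2 (S.opASigma y ζ)) ∧
      ∀ f : ℝ → R2, MemL2 f →
        ∃ ζ ∈ FrictionSystem.domain, S.opASigma y ζ =ᵐ[unitMeasure] f ∧
          ∀ ζ' ∈ FrictionSystem.domain, S.opASigma y ζ' =ᵐ[unitMeasure] f →
            Set.EqOn ζ' ζ (Set.Icc 0 1)) ∧
    -- `Ψ(y)` is invertible
    IsUnit (S.Ψ y) ∧
    -- existence, uniqueness, the formula, and the normalization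
    ∃ M : ℝ → Mat2,
      S.IsSolution y M ∧
      (∀ M' : ℝ → Mat2, S.IsSolution y M' → Set.EqOn M' M (Set.Icc 0 1)) ∧
      (∀ ξ ∈ Set.Icc (0 : ℝ) 1, M ξ = -(S.invASigmaH y ξ * (S.Ψ y)⁻¹)) ∧
      S.matK₁ M = 1 := by
  refine ⟨⟨fun ζ hζ => S.memL2_opASigma y hζ, fun f hf => ?_⟩,
    FrictionSystem.isUnit_Ψ h₁ h₂ y, _,
    FrictionSystem.isSolution_neg_invASigmaH h₁ h₂ y,
    fun M' hM' => hM'.eqOn h₁ h₂ (FrictionSystem.isSolution_neg_invASigmaH h₁ h₂ y),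
    fun ξ _ => rfl, FrictionSystem.matK₁_neg_invASigmaH h₁ h₂ y⟩
  obtain ⟨ζ, hζ, hζf⟩ := FrictionSystem.exists_opASigma_eq h₁ h₂ y hf
  exact ⟨ζ, hζ, hζf, fun ζ' hζ' hζ'f =>
    FrictionSystem.eqOn_of_opASigma_eq h₁ h₂ y hζ' hζ (hζ'f.trans hζf.symm)⟩
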